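/- Let $\mathbb K=\mathbb R$ or $\mathbb C$, let $n\ge 0$, and let $\lambda=(\lambda_1,\dots,\lambda_n)\in\mathbb K^n$ be non-resonant: $\sum_k j_k\lambda_k\neq 0$ for every $j\in\mathbb Z^n\setminus\{0\}$. Consider formal (in particular, analytic) hamiltonians $$H(x,y)=\sum_{l\ge 2}H_l(x,y)\in\mathbb K[[x_1,\dots,x_n,y_1,\dots,y_n]],\qquad H_2=\sum_{k=1}^n\lambda_kx_ky_k,$$ where $H_l$ is homogeneous of degree $l$. A formal series $v(x,\eta)=\sum_k x_k\eta_k+(\text{terms of degree}\ge 3)$ generates a formal canonical transformation $(x,y)\leftrightarrow(\xi,\eta)$ fixing the origin through $$\xi_k=\frac{\partial v}{\partial\eta_k}(x,\eta),\qquad y_k=\frac{\partial v}{\partial x_k}(x,\eta)\qquad(1\le k\le n).$$ Call $v$ a *Birkhoff generating series* of $H$ if, when $x,y$ are expressed as formal power series in $(\xi,\eta)$, the new hamiltonian $K(\xi,\eta)=H(x(\xi,\eta),y(\xi,\eta))$ is a formal power series in the products $\xi_1\eta_1,\dots,\xi_n\eta_n$, and the series $\sum_k(\xi_ky_k-\eta_kx_k)$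 contains no monomial that is a product of powers of the $\xi_k\eta_k$. Let $F$ be a formal power series in $n$ variables over $\mathbb K$. The universal formal first integral attached to $F$ is $$P(H)(x,y)=F(\omega_1,\dots,\omega_n),\qquad \omega_k=\xi_k(x,y)\,\eta_k(x,y),$$ where $\xi(x,y),\eta(x,y)$ are the new variables, defined by a Birkhoff generating series of $H$, expressed as formal power series in $(x,y)$. **Corollary 1.4.** For fixed $\lambda$ and $F$, every such $H$ has exactly one universal formal first integral $P(H)$ attached to $F$. For every $l\ge 1$ and every monomial of degree $l$ in $(x,y)$ there is a polynomial $Q$ with coefficients in $\mathbb K$, not depending on $H$, of total degree at most $l-1$, such that for every such $H$ the coefficient of this monomial in $P(H)$ is the value of $Q$ at the coefficients of $H_3,\dots,H_{l+1}$. The constant term of $P(H)$ does not depend on $H$. -/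

import Mathlib

open MvPowerSeries

namespace Birkhoff

/-- The exponents of monomials in `2n` variables. The index `Sum.inl k` stands for the `k`-th
variable of the first group (`x_k` or `ξ_k`), and `Sum.inr k` for the `k`-th variable of the second
group (`y_k` or `η_k`). -/
abbrev Exponent (n : ℕ) : Type := (Fin n ⊕ Fin n) →₀ ℕ

/-- Formal power series in `2n` variables. -/
abbrev Series (𝕜 : Type*) (n : ℕ) : Type _ := MvPowerSeries (Fin n ⊕ Fin n) 𝕜

variable {𝕜 : Type*} [Field 𝕜] {n : ℕ}

/-- The quadratic form `∑ k, lam k * x_k * y_k`. -/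
noncomputable def quadraticPart (lam : Fin n → 𝕜) : Series 𝕜 n :=
  ∑ k, C (lam k) * (X (Sum.inl k) * X (Sum.inr k))

/-- `f = ∑ k, lam k * x_k * y_k + (terms of degree at least 3)`. -/
def HasQuadraticPart (lam : Fin n → 𝕜) (f : Series 𝕜 n) : Prop :=
  ∀ d : Exponent n, d.degree ≤ 2 → coeff d f = coeff d (quadraticPart lam)

/-- No nontrivial integer combination of the `lam k` vanishes. -/
def NonResonant (lam : Fin n → 𝕜) : Prop :=
  ∀ j : Fin n → ℤ, ∑ k, (j k : 𝕜) * lam k = 0 → j = 0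

/-- The monomial with exponent `d` is a product of powers of the products
`ω_k = ξ_k * η_k`. -/
def IsBalanced (d : Exponent n) : Prop := ∀ k, d (Sum.inl k) = d (Sum.inr k)

/-- The substitution `f (a, b)`: the two groups of variables of `f` are replaced by the
families `a` and `b` (meaningful when these have no constant terms). -/
noncomputable def substPair (a b : Fin n → Series 𝕜 n) (f : Series 𝕜 n) : Series 𝕜 n :=
  subst (Sum.elim a b) f

/-- The old variables as series in the new ones: `x = φ (ξ, η)`, `y = ψ (ξ, η)` is the solution,
fixing the origin, of `ξ_k = ∂v/∂η_k (x, η)`, `y_k = ∂v/∂x_k (x, η)`. -/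
structure IsGenerated (v : Series 𝕜 n) (φ ψ : Fin n → Series 𝕜 n) : Prop where
  constantCoeff_fst : ∀ k, constantCoeff (φ k) = 0
  constantCoeff_snd : ∀ k, constantCoeff (ψ k) = 0
  eq_fst : ∀ k, X (Sum.inl k) = substPair φ (fun j => X (Sum.inr j)) (pderiv 𝕜 (Sum.inr k) v)
  eq_snd : ∀ k, ψ k = substPair φ (fun j => X (Sum.inr j)) (pderiv 𝕜 (Sum.inl k) v)

/-- The new variables as series in the old ones: `ξ = ξ (x, y)`, `η = η (x, y)` is the solution,
fixing the origin, of the same equations `ξ_k = ∂v/∂η_k (x, η)`, `y_k = ∂v/∂x_k (x, η)`. -/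
structure IsGeneratedInverse (v : Series 𝕜 n) (ξ η : Fin n → Series 𝕜 n) : Prop where
  constantCoeff_fst : ∀ k, constantCoeff (ξ k) = 0
  constantCoeff_snd : ∀ k, constantCoeff (η k) = 0
  eq_fst : ∀ k, ξ k = substPair (fun j => X (Sum.inl j)) η (pderiv 𝕜 (Sum.inr k) v)
  eq_snd : ∀ k, X (Sum.inr k) = substPair (fun j => X (Sum.inl j)) η (pderiv 𝕜 (Sum.inl k) v)

/-- `v (x, η) = ∑ x_k * η_k + (terms of degree at least 3)` is the generating series of the
normalized formal canonical transformation taking `H` to its Birkhoff normal form. -/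
def IsBirkhoffGenerating (H v : Series 𝕜 n) : Prop :=
  HasQuadraticPart (fun _ => 1) v ∧
  ∃ φ ψ : Fin n → Series 𝕜 n, IsGenerated v φ ψ ∧
    -- the new hamiltonian is a formal power series in the products `ξ_k * η_k`
    (∀ d : Exponent n, ¬ IsBalanced d → coeff d (substPair φ ψ H) = 0) ∧
    -- `∑ (ξ_k * y_k - η_k * x_k)` contains no product of powers of the `ξ_k * η_k`
    (∀ d : Exponent n, IsBalanced d →
      coeff d (∑ k, (X (Sum.inl k) * ψ k - X (Sum.inr k) * φ k)) = 0)

/-- `P` is the universal formal first integral `P(H) = F (ω_1, …, ω_n)` of `H` attached to `F`,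
as a series in the original variables `(x, y)`; here `ω_k = ξ_k (x, y) * η_k (x, y)`. -/
def IsUniversalFirstIntegral (F : MvPowerSeries (Fin n) 𝕜) (H P : Series 𝕜 n) : Prop :=
  ∃ (v : Series 𝕜 n) (ξ η : Fin n → Series 𝕜 n),
    IsBirkhoffGenerating H v ∧ IsGeneratedInverse v ξ η ∧
      P = subst (fun k => ξ k * η k) F

/-- The exponents of the monomials of the homogeneous parts `H_3, …, H_{l+1}`. -/
abbrev HigherExponent (n l : ℕ) : Type :=
  {d : Exponent n // 3 ≤ d.degree ∧ d.degree ≤ l + 1}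

end Birkhoff

/-! Write `v = ∑ x_k η_k + w` with `w` of order at least 3. If the coefficients of `w` in degree `l`
change, then to leading order `x` changes by `-∂w/∂η` and `y` by `∂w/∂x`. Hence `∑ (ξ_k y_k - η_k
x_k)` changes by the Euler operator applied to `w`, and `H(x, y)` by `∑ λ_k (ξ_k ∂_{ξ_k} - η_k
∂_{η_k}) w` (`residual_sub_residual`). Both operators are diagonal on monomials. The first has
eigenvalue the degree, needed on balanced monomials; the second has eigenvalue `∑ λ_k j_k`, nonzero
on the others by non-resonance. So the Birkhoff conditions determine `w` degree by degree: Birkhoff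
generating series are the fixed points of a map `step` that contracts for the degree filtration.

For the dependence on `H`, give a coefficient of `H_l` the weight `l - 2`. All operations used
(products, derivatives, substitution, division by the constant eigenvalues) respect the rule that a
series of order `c` has coefficients of weight at most `degree - c`. The iteration preserves this
rule, and so does its limit. As `P(H) - F(0)` has order 2, its coefficients of degree `l` have
weight at most `l - 2`, which bounds both the degree of the polynomial and the `H_j` that occur.

The predicate `HasFilteredOrder` covers both halves: the trivial filtration gives orders of
vanishing for the contraction argument, and `coeffWeight` gives the weights. -/

namespace Birkhoff

/-! ### Calculus of filtered orders for families of power series. -/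

section FilteredOrder

variable {𝕜 ι σ τ : Type*} [Field 𝕜]

/-- A multiplicative filtration, concentrated in nonnegative degrees, of the algebra of
`𝕜`-valued functions on `ι`. -/
class IsCoeffFiltration (W : ℤ → Submodule 𝕜 (ι → 𝕜)) : Prop where
  one_mem : 1 ∈ W 0
  mono : Monotone W
  mul_mem : ∀ {a b : ℤ} {p q : ι → 𝕜}, p ∈ W a → q ∈ W b → p * q ∈ W (a + b)
  eq_zero : ∀ {k : ℤ} {p : ι → 𝕜}, k < 0 → p ∈ W k → p = 0

/-- The family `f` of power series vanishes to order `c`, and its coefficients of degree `l` depend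
on the parameter through functions in the step `l - c` of the filtration `W`. -/
def HasFilteredOrder (W : ℤ → Submodule 𝕜 (ι → 𝕜)) (c : ℤ) (f : ι → MvPowerSeries σ 𝕜) : Prop :=
  ∀ d : σ →₀ ℕ, (fun i => coeff d (f i)) ∈ W (d.degree - c)

namespace HasFilteredOrder

variable {W : ℤ → Submodule 𝕜 (ι → 𝕜)} {b c : ℤ} {f g : ι → MvPowerSeries σ 𝕜}

theorem zero : HasFilteredOrder W c (fun _ => (0 : MvPowerSeries σ 𝕜)) := fun d => by
  simp only [map_zero]
  exact (W _).zero_mem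

theorem add (hf : HasFilteredOrder W c f) (hg : HasFilteredOrder W c g) :
    HasFilteredOrder W c (fun i => f i + g i) := fun d => by
  simpa using! (W _).add_mem (hf d) (hg d)

theorem sub (hf : HasFilteredOrder W c f) (hg : HasFilteredOrder W c g) :
    HasFilteredOrder W c (fun i => f i - g i) := fun d => by
  simpa using! (W _).sub_mem (hf d) (hg d)

theorem smul (a : 𝕜) (hf : HasFilteredOrder W c f) :
    HasFilteredOrder W c (fun i => a • f i) := fun d => by
  simpa using! (W _).smul_mem a (hf d)

theorem sum {κ : Type*} {s : Finset κ} {f : κ → ι → MvPowerSeries σ 𝕜}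
    (hf : ∀ k ∈ s, HasFilteredOrder W c (f k)) :
    HasFilteredOrder W c (fun i => ∑ k ∈ s, f k i) := fun d => by
  have h := (W (d.degree - c)).sum_mem fun k hk => hf k hk d
  convert h using 1
  ext i
  simp

variable [IsCoeffFiltration W]

theorem mono (hf : HasFilteredOrder W c f) (h : b ≤ c) : HasFilteredOrder W b f := fun d =>
  IsCoeffFiltration.mono (W := W) (by lia) (hf d)

theorem coeff_eq_zero (hf : HasFilteredOrder W c f) {d : σ →₀ ℕ} (hd : (d.degree : ℤ) < c)
    (i : ι) : coeff d (f i) = 0 :=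
  congrFun (IsCoeffFiltration.eq_zero (W := W) (by lia) (hf d)) i

theorem constantCoeff_eq_zero (hf : HasFilteredOrder W c f) (hc : 1 ≤ c) (i : ι) :
    constantCoeff (f i) = 0 := by
  rw [← coeff_zero_eq_constantCoeff_apply]
  exact hf.coeff_eq_zero (by simpa using by lia) i

theorem of_coeff (a : MvPowerSeries σ 𝕜) (ha : ∀ d, (d.degree : ℤ) < c → coeff d a = 0) :
    HasFilteredOrder W c (fun _ => a) := fun d => by
  by_cases h : (d.degree : ℤ) < c
  · simp only [ha d h]
    exact (W _).zero_mem
  · have h1 := (W 0).smul_mem (coeff d a) IsCoeffFiltration.one_mem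
    have h2 : (fun _ : ι => coeff d a) = coeff d a • (1 : ι → 𝕜) := by ext; simp
    rw [h2]
    exact IsCoeffFiltration.mono (W := W) (by lia) h1

theorem one : HasFilteredOrder W 0 (fun _ => (1 : MvPowerSeries σ 𝕜)) :=
  of_coeff _ fun d hd => by lia

theorem X (s : σ) : HasFilteredOrder W 1 (fun _ => (X s : MvPowerSeries σ 𝕜)) :=
  of_coeff _ fun d hd => by
    classical
    rw [coeff_X, if_neg]
    rintro rfl
    simp at hd

theorem mul (hf : HasFilteredOrder W b f) (hg : HasFilteredOrder W c g) :
    HasFilteredOrder W (b + c) (fun i => f i * g i) := fun d => by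
  classical
  have h : (fun i => coeff d (f i * g i)) =
      ∑ p ∈ Finset.HasAntidiagonal.antidiagonal d, (fun i => coeff p.1 (f i)) * (fun i => coeff p.2 (g i)) := by
    ext i
    simp [coeff_mul]
  rw [h]
  refine Submodule.sum_mem _ fun p hp => ?_
  have hd : p.1.degree + p.2.degree = d.degree := by
    rw [← map_add, Finset.HasAntidiagonal.mem_antidiagonal.mp hp]
  have := IsCoeffFiltration.mul_mem (hf p.1) (hg p.2)
  exact IsCoeffFiltration.mono (W := W) (by lia) this

theorem pow (hf : HasFilteredOrder W c f) (k : ℕ) :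
    HasFilteredOrder W (k * c) (fun i => f i ^ k) := by
  induction k with
  | zero => simpa using one
  | succ k ih =>
    simp only [pow_succ]
    exact (ih.mul hf).mono (by push_cast; linarith)

theorem finsuppProd {κ : Type*} {a : κ → ι → MvPowerSeries σ 𝕜}
    (ha : ∀ k, HasFilteredOrder W c (a k)) (e : κ →₀ ℕ) :
    HasFilteredOrder W (e.degree * c) (fun i => e.prod fun k m => a k i ^ m) := by
  classical
  induction e using Finsupp.induction_linear with
  | zero => simpa using one
  | add e e' he he' =>
    have h (i : ι) : ((e + e').prod fun k m => a k i ^ m) =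
        (e.prod fun k m => a k i ^ m) * (e'.prod fun k m => a k i ^ m) :=
      Finsupp.prod_add_index' (by simp) (by simp [pow_add])
    simp only [h]
    exact (he.mul he').mono (by simp [add_mul])
  | single k m => simpa using (ha k).pow m

theorem pderiv (s : σ) (hf : HasFilteredOrder W c f) :
    HasFilteredOrder W (c - 1) (fun i => pderiv 𝕜 s (f i)) := fun d => by
  have h := (W _).smul_mem (d s + 1 : 𝕜) (hf (d + Finsupp.single s 1))
  have h2 : (fun i => coeff d (MvPowerSeries.pderiv 𝕜 s (f i))) =
      (d s + 1 : 𝕜) • fun i => coeff (d + Finsupp.single s 1) (f i) := by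
    ext i
    simp [coeff_pderiv, mul_comm]
  rw [h2]
  refine IsCoeffFiltration.mono (W := W) ?_ h
  simp
  lia

/-- Telescoping through `u v - u' v' = (u - u') v + u' (v - v')`: one factor of order 1 is traded
for a difference of order `q`. -/
theorem finsuppProd_sub {κ : Type*} {q : ℤ} {a a' : κ → ι → MvPowerSeries σ 𝕜}
    (ha : ∀ k, HasFilteredOrder W 1 (a k)) (ha' : ∀ k, HasFilteredOrder W 1 (a' k))
    (h : ∀ k, HasFilteredOrder W q (fun i => a k i - a' k i)) (e : κ →₀ ℕ) :
    HasFilteredOrder W (e.degree - 1 + q)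
      (fun i => (e.prod fun k m => a k i ^ m) - e.prod fun k m => a' k i ^ m) := by
  classical
  have hprod (e e' : κ →₀ ℕ) (a : κ → ι → MvPowerSeries σ 𝕜) (i : ι) :
      ((e + e').prod fun k m => a k i ^ m) =
        (e.prod fun k m => a k i ^ m) * (e'.prod fun k m => a k i ^ m) :=
    Finsupp.prod_add_index' (by simp) (by simp [pow_add])
  have hmul {u u' v v' : ι → MvPowerSeries σ 𝕜} {b c : ℤ}
      (hu : HasFilteredOrder W (b - 1 + q) (fun i => u i - u' i)) (hu' : HasFilteredOrder W b u')
      (hv : HasFilteredOrder W c v) (hvv : HasFilteredOrder W (c - 1 + q) (fun i => v i - v' i)) :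
      HasFilteredOrder W (b + c - 1 + q) (fun i => u i * v i - u' i * v' i) := by
    have h1 := ((hu.mul hv).mono (b := b + c - 1 + q) (by lia)).add
      ((hu'.mul hvv).mono (b := b + c - 1 + q) (by lia))
    convert h1 using 2
    ring
  induction e using Finsupp.induction_linear with
  | zero => simpa using zero
  | add e e' he he' =>
    simp only [hprod]
    refine (hmul (c := e'.degree) he ((finsuppProd ha' e).mono (by simp))
      ((finsuppProd ha e').mono (by simp)) ?_).mono (by simp)
    exact he'.mono (by simp)
  | single k m =>
    simp only [pow_zero, Finsupp.prod_single_index, Finsupp.degree_single]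
    induction m with
    | zero => simpa using zero
    | succ m ih =>
      simp only [pow_succ]
      refine (hmul (c := 1) ih (((ha' k).pow m).mono (by simp)) (ha k) ?_).mono (by simp)
      exact (h k).mono (by simp)

end HasFilteredOrder

/-- The coarsest coefficient filtration: it only records the order of vanishing. -/
instance isCoeffFiltration_trivial :
    IsCoeffFiltration (fun k : ℤ => if k < 0 then (⊥ : Submodule 𝕜 (ι → 𝕜)) else ⊤) where
  one_mem := by simp
  mono a b h := by
    by_cases ha : a < 0
    · simp [ha]
    · simp [ha, show ¬ b < 0 by lia]
  mul_mem {a b p q} hp hq := by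
    by_cases ha : a < 0
    · simp_all
    by_cases hb : b < 0
    · simp_all
    simp [show ¬ a + b < 0 by lia]
  eq_zero hk hp := by simpa [hk] using hp

/-- Without constant terms in the `a s`, exponents of degree above `d.degree` contribute nothing.
The index set is thus finite and independent of `f` and `a`, so a family of such coefficients is a
finite sum in the function algebra. -/
theorem coeff_subst_eq_sum [Finite σ] {a : σ → MvPowerSeries τ 𝕜}
    (ha : ∀ s, constantCoeff (a s) = 0) (f : MvPowerSeries σ 𝕜) (d : τ →₀ ℕ) :
    coeff d (subst a f) = ∑ e ∈ (Finsupp.finite_of_degree_le (σ := σ) d.degree).toFinset,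
      coeff e f * coeff d (e.prod fun s m => a s ^ m) := by
  rw [coeff_subst (hasSubst_of_constantCoeff_zero ha)]
  refine finsum_eq_sum_of_support_subset _ fun e he => ?_
  simp only [Set.Finite.coe_toFinset, Set.mem_ofPred_eq]
  by_contra! h
  refine he ?_
  have ha1 (s : σ) : HasFilteredOrder (fun k : ℤ => if k < 0 then ⊥ else ⊤) 1
      (fun _ : Unit => a s) := HasFilteredOrder.of_coeff _ fun d hd => by
    have : d = 0 := by rw [← Finsupp.degree_eq_zero_iff]; lia
    simpa [this] using ha s
  have := (HasFilteredOrder.finsuppProd ha1 e).coeff_eq_zero (d := d) (by simpa using h) ()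
  simp only [this, smul_zero]

namespace HasFilteredOrder

variable {W : ℤ → Submodule 𝕜 (ι → 𝕜)} [IsCoeffFiltration W] [Finite σ] {c : ℤ}

theorem subst_of_coeff {r : ℤ} (hr : 1 ≤ r) {f : ι → MvPowerSeries σ 𝕜}
    {a : σ → ι → MvPowerSeries τ 𝕜} (ha : ∀ s, HasFilteredOrder W r (a s))
    (hf : ∀ e : σ →₀ ℕ, (fun i => coeff e (f i)) ∈ W (e.degree * r - c)) :
    HasFilteredOrder W c (fun i => subst (fun s => a s i) (f i)) := fun d => by
  have h : (fun i => coeff d (subst (fun s => a s i) (f i))) =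
      ∑ e ∈ (Finsupp.finite_of_degree_le (σ := σ) d.degree).toFinset,
        (fun i => coeff e (f i)) * (fun i => coeff d (e.prod fun s m => a s i ^ m)) := by
    ext i
    simp [coeff_subst_eq_sum fun s => (ha s).constantCoeff_eq_zero hr i]
  rw [h]
  refine Submodule.sum_mem _ fun e _ => ?_
  have := IsCoeffFiltration.mul_mem (hf e) (finsuppProd ha e d)
  exact IsCoeffFiltration.mono (W := W) (by lia) this

theorem subst {f : ι → MvPowerSeries σ 𝕜} {a : σ → ι → MvPowerSeries τ 𝕜}
    (hf : HasFilteredOrder W c f) (ha : ∀ s, HasFilteredOrder W 1 (a s)) :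
    HasFilteredOrder W c (fun i => MvPowerSeries.subst (fun s => a s i) (f i)) :=
  subst_of_coeff le_rfl ha fun e => by simpa using hf e

theorem subst_sub_subst {q : ℤ} {f : ι → MvPowerSeries σ 𝕜} {a a' : σ → ι → MvPowerSeries τ 𝕜}
    (hf : HasFilteredOrder W c f) (ha : ∀ s, HasFilteredOrder W 1 (a s))
    (ha' : ∀ s, HasFilteredOrder W 1 (a' s))
    (h : ∀ s, HasFilteredOrder W q (fun i => a s i - a' s i)) :
    HasFilteredOrder W (c - 1 + q) (fun i =>
      MvPowerSeries.subst (fun s => a s i) (f i) - MvPowerSeries.subst (fun s => a' s i) (f i)) :=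
  fun d => by
    have h1 : (fun i => coeff d (MvPowerSeries.subst (fun s => a s i) (f i) -
          MvPowerSeries.subst (fun s => a' s i) (f i))) =
        ∑ e ∈ (Finsupp.finite_of_degree_le (σ := σ) d.degree).toFinset,
          (fun i => coeff e (f i)) * (fun i => coeff d
            ((e.prod fun s m => a s i ^ m) - e.prod fun s m => a' s i ^ m)) := by
      ext i
      simp [coeff_subst_eq_sum fun s => (ha s).constantCoeff_eq_zero le_rfl i,
        coeff_subst_eq_sum fun s => (ha' s).constantCoeff_eq_zero le_rfl i, mul_sub]
    rw [h1]
    refine Submodule.sum_mem _ fun e _ => ?_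
    have := IsCoeffFiltration.mul_mem (hf e) (finsuppProd_sub ha ha' h e d)
    exact IsCoeffFiltration.mono (W := W) (by lia) this

end HasFilteredOrder

end FilteredOrder
-- Fixed points of maps contracting for a shifted degree.
section FixedPoint

variable {κ σ R : Type*} [Semiring R]

/-- The coefficients of `u` and `u'` of shifted degree below `N` coincide. -/
def AgreeBelow (s : κ → ℕ) (N : ℕ) (u u' : κ → MvPowerSeries σ R) : Prop :=
  ∀ k (d : σ →₀ ℕ), d.degree + s k < N → coeff d (u k) = coeff d (u' k)

theorem agreeBelow_iterate {s : κ → ℕ} {S : Set (κ → MvPowerSeries σ R)}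
    {T : (κ → MvPowerSeries σ R) → κ → MvPowerSeries σ R} (hS : Set.MapsTo T S S)
    (hT : ∀ N, ∀ u ∈ S, ∀ u' ∈ S, AgreeBelow s N u u' → AgreeBelow s (N + 1) (T u) (T u'))
    {u u' : κ → MvPowerSeries σ R} (hu : u ∈ S) (hu' : u' ∈ S) (N : ℕ) :
    AgreeBelow s N (T^[N] u) (T^[N] u') := by
  induction N with
  | zero => exact fun k d h => by lia
  | succ N ih =>
    simp only [Function.iterate_succ_apply']
    exact hT N _ (hS.iterate N hu) _ (hS.iterate N hu') ih

theorem eq_of_isFixedPt {s : κ → ℕ} {S : Set (κ → MvPowerSeries σ R)}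
    {T : (κ → MvPowerSeries σ R) → κ → MvPowerSeries σ R} (hS : Set.MapsTo T S S)
    (hT : ∀ N, ∀ u ∈ S, ∀ u' ∈ S, AgreeBelow s N u u' → AgreeBelow s (N + 1) (T u) (T u'))
    {u u' : κ → MvPowerSeries σ R} (hu : u ∈ S) (hu' : u' ∈ S)
    (h : Function.IsFixedPt T u) (h' : Function.IsFixedPt T u') : u = u' := by
  ext k d
  have := agreeBelow_iterate hS hT hu hu' (d.degree + s k + 1) k d (by lia)
  rwa [h.iterate, h'.iterate] at this

/-- The agreement with the iterates is part of the conclusion because it is what carries filtered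
orders from the iterates to the limit. -/
theorem exists_isFixedPt {s : κ → ℕ} {S : Set (κ → MvPowerSeries σ R)}
    {T : (κ → MvPowerSeries σ R) → κ → MvPowerSeries σ R} (hS : Set.MapsTo T S S)
    (hT : ∀ N, ∀ u ∈ S, ∀ u' ∈ S, AgreeBelow s N u u' → AgreeBelow s (N + 1) (T u) (T u'))
    (hclosed : ∀ u, (∀ N, ∃ u' ∈ S, AgreeBelow s N u u') → u ∈ S)
    {u₀ : κ → MvPowerSeries σ R} (h₀ : u₀ ∈ S) :
    ∃ u ∈ S, Function.IsFixedPt T u ∧ ∀ N, AgreeBelow s N u (T^[N] u₀) := by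
  -- Each coefficient is read off at the first iterate from which it is guaranteed to be stable.
  let u : κ → MvPowerSeries σ R := fun k d => coeff d (T^[d.degree + s k + 1] u₀ k)
  have hu (N : ℕ) : AgreeBelow s N u (T^[N] u₀) := fun k d hd => by
    obtain ⟨m, rfl⟩ : ∃ m, N = d.degree + s k + 1 + m := ⟨N - (d.degree + s k + 1), by lia⟩
    -- Comparing the starting points `u₀` and `T^[m] u₀` shows that the iterates stabilize.
    have := agreeBelow_iterate hS hT h₀ (hS.iterate m h₀) (d.degree + s k + 1) k d (by lia)
    rwa [← Function.iterate_add_apply] at this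
  have huS : u ∈ S := hclosed u fun N => ⟨_, hS.iterate N h₀, hu N⟩
  refine ⟨u, huS, ?_, hu⟩
  ext k d
  have h1 := hT _ _ huS _ (hS.iterate _ h₀) (hu (d.degree + s k)) k d (by lia)
  rw [h1, ← Function.iterate_succ_apply' T]
  exact (hu (d.degree + s k + 1) k d (by lia)).symm

end FixedPoint

/-! ### Order of vanishing and substitution near the identity. -/

section HasOrder

variable {𝕜 σ τ : Type*} [Field 𝕜]

/-- The power series `f` has no monomials of degree less than `c`. -/
abbrev HasOrder (c : ℤ) (f : MvPowerSeries σ 𝕜) : Prop :=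
  HasFilteredOrder (fun k : ℤ => if k < 0 then (⊥ : Submodule 𝕜 (Unit → 𝕜)) else ⊤) c (fun _ => f)

theorem hasOrder_iff {c : ℤ} {f : MvPowerSeries σ 𝕜} :
    HasOrder c f ↔ ∀ d, (d.degree : ℤ) < c → coeff d f = 0 :=
  ⟨fun h _ hd => h.coeff_eq_zero hd (), HasFilteredOrder.of_coeff f⟩

theorem hasOrder_one_iff {f : MvPowerSeries σ 𝕜} : HasOrder 1 f ↔ constantCoeff f = 0 := by
  refine ⟨fun h => h.constantCoeff_eq_zero le_rfl (), fun h => hasOrder_iff.mpr fun d hd => ?_⟩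
  have : d = 0 := by rw [← Finsupp.degree_eq_zero_iff]; lia
  simpa [this] using h

theorem hasOrder_X (s : σ) : HasOrder 1 (X s : MvPowerSeries σ 𝕜) := HasFilteredOrder.X s

theorem HasOrder.constantCoeff_eq_zero {f : MvPowerSeries σ 𝕜} (h : HasOrder 1 f) :
    constantCoeff f = 0 :=
  hasOrder_one_iff.mp h

theorem HasOrder.of_sub_X {s : σ} {f : MvPowerSeries σ 𝕜} (h : HasOrder 2 (f - MvPowerSeries.X s)) :
    HasOrder 1 f := by
  simpa using (h.mono (b := 1) (by norm_num)).add (hasOrder_X s)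

theorem agreeBelow_iff_hasOrder {κ : Type*} {s : κ → ℕ} {N : ℕ} {u u' : κ → MvPowerSeries σ 𝕜} :
    AgreeBelow s N u u' ↔ ∀ k, HasOrder (N - s k) (u k - u' k) := by
  simp only [hasOrder_iff, AgreeBelow, map_sub, sub_eq_zero]
  exact forall_congr' fun k => forall_congr' fun d => by
    rw [lt_sub_iff_add_lt]
    norm_cast

theorem hasOrder_subst_sub [Finite σ] {c : ℤ} {f f' : MvPowerSeries σ 𝕜}
    {a a' : σ → MvPowerSeries τ 𝕜} (ha : ∀ s, HasOrder 1 (a s)) (ha' : ∀ s, HasOrder 1 (a' s))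
    (hf' : HasOrder 2 f') (hff : HasOrder c (f - f')) (haa : ∀ s, HasOrder (c - 1) (a s - a' s)) :
    HasOrder c (subst a f - subst a' f') := by
  have h1 := HasFilteredOrder.subst (a := fun s _ => a s) hff ha
  have h2 := HasFilteredOrder.subst_sub_subst (a := fun s _ => a s) (a' := fun s _ => a' s)
    hf' ha ha' haa
  convert h1.add (h2.mono (b := c) (by lia)) using 2
  rw [subst_sub (hasSubst_of_constantCoeff_zero fun s => (ha s).constantCoeff_eq_zero)]
  ring

/-- Near the identity, substitution preserves the leading part of a difference. -/
theorem hasOrder_subst_sub_sub [Finite σ] {c : ℤ} {f f' : MvPowerSeries σ 𝕜}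
    {a a' : σ → MvPowerSeries σ 𝕜} (ha : ∀ s, HasOrder 2 (a s - X s))
    (ha' : ∀ s, HasOrder 2 (a' s - X s)) (hf' : HasOrder 2 f') (hff : HasOrder c (f - f'))
    (haa : ∀ s, HasOrder c (a s - a' s)) :
    HasOrder (c + 1) (subst a f - subst a' f' - (f - f')) := by
  have ha1 (s : σ) : HasOrder 1 (a s) := (ha s).of_sub_X
  have ha1' (s : σ) : HasOrder 1 (a' s) := (ha' s).of_sub_X
  have h1 := HasFilteredOrder.subst_sub_subst (a := fun s _ => a s) (a' := fun s _ => X s)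
    hff ha1 hasOrder_X ha
  have h2 := HasFilteredOrder.subst_sub_subst (a := fun s _ => a s) (a' := fun s _ => a' s)
    hf' ha1 ha1' haa
  convert (h1.mono (b := c + 1) (by lia)).add (h2.mono (b := c + 1) (by lia)) using 2
  rw [subst_sub (hasSubst_of_constantCoeff_zero fun s => (ha1 s).constantCoeff_eq_zero),
    show (fun s => (X s : MvPowerSeries σ 𝕜)) = X from rfl, subst_self]
  simp only [id]
  ring

theorem coeff_X_mul_pderiv (s : σ) (f : MvPowerSeries σ 𝕜) (d : σ →₀ ℕ) :
    coeff d (X s * pderiv 𝕜 s f) = d s * coeff d f := by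
  classical
  rcases Nat.eq_zero_or_pos (d s) with h | h
  · rw [X, coeff_monomial_mul, if_neg, h]
    · simp
    · simp [h]
  · obtain ⟨e, rfl⟩ : ∃ e, d = Finsupp.single s 1 + e :=
      ⟨d - Finsupp.single s 1, (add_tsub_cancel_of_le (by simpa using Nat.succ_le_of_lt h)).symm⟩
    rw [X, coeff_add_monomial_mul, coeff_pderiv, add_comm e]
    simp
    ring

end HasOrder

/-! ### The normalization equations and their linearization. -/

section Normalization

variable {𝕜 : Type*} [Field 𝕜] {n : ℕ}

/-- `ξ_k - ∂w/∂η_k (φ, η)`: solving `ξ = ∂v/∂η (x, η)` for the leading term of `x`, where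
`v = ∑ x_k η_k + w`. -/
noncomputable def oldFst (w : Series 𝕜 n) (φ : Fin n → Series 𝕜 n) (k : Fin n) : Series 𝕜 n :=
  X (Sum.inl k) - substPair φ (fun j => X (Sum.inr j)) (pderiv 𝕜 (Sum.inr k) w)

/-- `η_k + ∂w/∂x_k (φ, η)`: the value of `y_k = ∂v/∂x_k (x, η)` for `v = ∑ x_k η_k + w`. -/
noncomputable def oldSnd (w : Series 𝕜 n) (φ : Fin n → Series 𝕜 n) (k : Fin n) : Series 𝕜 n :=
  X (Sum.inr k) + substPair φ (fun j => X (Sum.inr j)) (pderiv 𝕜 (Sum.inl k) w)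

/-- The series `∑ (ξ_k y_k - η_k x_k)`. -/
noncomputable def normalizer (φ ψ : Fin n → Series 𝕜 n) : Series 𝕜 n :=
  ∑ k, (X (Sum.inl k) * ψ k - X (Sum.inr k) * φ k)

open Classical in
/-- The coefficients that have to vanish in order that `(φ, ψ)` brings `H` to normal form and is
normalized. -/
noncomputable def residual (H : Series 𝕜 n) (φ ψ : Fin n → Series 𝕜 n) (d : Exponent n) : 𝕜 :=
  if IsBalanced d then coeff d (normalizer φ ψ) else coeff d (substPair φ ψ H)

open Classical in
/-- The factor by which the coefficient of `w` at `d` enters the residual linearly. -/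
noncomputable def divisor (lam : Fin n → 𝕜) (d : Exponent n) : 𝕜 :=
  if IsBalanced d then d.degree else ∑ k, lam k * (d (Sum.inl k) - d (Sum.inr k))

/-- One step of the iteration for the higher order part `w` of the generating series. -/
noncomputable def correct (lam : Fin n → 𝕜) (H w : Series 𝕜 n) (φ : Fin n → Series 𝕜 n) :
    Series 𝕜 n :=
  fun d => coeff d w - (divisor lam d)⁻¹ * residual H (oldFst w φ) (oldSnd w φ) d

theorem coeff_correct (lam : Fin n → 𝕜) (H w : Series 𝕜 n) (φ : Fin n → Series 𝕜 n)
    (d : Exponent n) : coeff d (correct lam H w φ) =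
      coeff d w - (divisor lam d)⁻¹ * residual H (oldFst w φ) (oldSnd w φ) d :=
  rfl

/-- The iteration whose fixed point consists of the higher order part `w` of the Birkhoff
generating series and of the old variables `x_k` as series in the new ones. -/
noncomputable def step (lam : Fin n → 𝕜) (H : Series 𝕜 n) (u : Option (Fin n) → Series 𝕜 n) :
    Option (Fin n) → Series 𝕜 n
  | none => correct lam H (u none) fun k => u (some k)
  | some k => oldFst (correct lam H (u none) fun k => u (some k)) (fun k => u (some k)) k

section Filtered

variable {ι : Type*} {W : ℤ → Submodule 𝕜 (ι → 𝕜)} [IsCoeffFiltration W] {c : ℤ}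
  {H w : ι → Series 𝕜 n} {φ ψ : Fin n → ι → Series 𝕜 n}

theorem HasFilteredOrder.substPair {f : ι → Series 𝕜 n} (hf : HasFilteredOrder W c f)
    (hφ : ∀ k, HasFilteredOrder W 1 (φ k)) (hψ : ∀ k, HasFilteredOrder W 1 (ψ k)) :
    HasFilteredOrder W c (fun i => substPair (fun k => φ k i) (fun k => ψ k i) (f i)) := by
  refine (hf.subst (a := fun s i => Sum.elim (fun k => φ k i) (fun k => ψ k i) s) ?_)
  rintro (k | k)
  exacts [hφ k, hψ k]

theorem HasFilteredOrder.oldFst (hw : HasFilteredOrder W 2 w)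
    (hφ : ∀ k, HasFilteredOrder W 1 (φ k)) (k : Fin n) :
    HasFilteredOrder W 1 (fun i => oldFst (w i) (fun k => φ k i) k) :=
  (HasFilteredOrder.X _).sub
    ((hw.pderiv (Sum.inr k)).substPair (ψ := fun j _ => MvPowerSeries.X (Sum.inr j)) hφ
      fun _ => .X _)

theorem HasFilteredOrder.oldSnd (hw : HasFilteredOrder W 2 w)
    (hφ : ∀ k, HasFilteredOrder W 1 (φ k)) (k : Fin n) :
    HasFilteredOrder W 1 (fun i => oldSnd (w i) (fun k => φ k i) k) :=
  (HasFilteredOrder.X _).add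
    ((hw.pderiv (Sum.inl k)).substPair (ψ := fun j _ => MvPowerSeries.X (Sum.inr j)) hφ
      fun _ => .X _)

theorem HasFilteredOrder.normalizer (hφ : ∀ k, HasFilteredOrder W c (φ k))
    (hψ : ∀ k, HasFilteredOrder W c (ψ k)) :
    HasFilteredOrder W (1 + c) (fun i => normalizer (fun k => φ k i) (fun k => ψ k i)) :=
  .sum fun k _ => ((HasFilteredOrder.X _).mul (hψ k)).sub ((HasFilteredOrder.X _).mul (hφ k))

/-- The divisors depend only on `lam` and `d`, so they act as scalars on `W`. The orders 2 for `w`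
and 1 for `φ` reproduce themselves: a derivative loses one order and `normalizer` regains it. -/
theorem HasFilteredOrder.correct (lam : Fin n → 𝕜) (hH : HasFilteredOrder W 2 H)
    (hw : HasFilteredOrder W 2 w) (hφ : ∀ k, HasFilteredOrder W 1 (φ k)) :
    HasFilteredOrder W 2 (fun i => correct lam (H i) (w i) (fun k => φ k i)) := fun d => by
  have h1 := hw.oldFst hφ
  have h2 := hw.oldSnd hφ
  refine (W _).sub_mem (hw d) ((W _).smul_mem (divisor lam d)⁻¹ (x := fun i => residual (H i)
    (Birkhoff.oldFst (w i) fun k => φ k i) (Birkhoff.oldSnd (w i) fun k => φ k i) d) ?_)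
  by_cases hd : IsBalanced d
  · simp only [residual, if_pos hd]
    exact HasFilteredOrder.normalizer h1 h2 d
  · simp only [residual, if_neg hd]
    exact hH.substPair h1 h2 d

theorem HasFilteredOrder.step (lam : Fin n → 𝕜) (hH : HasFilteredOrder W 2 H)
    {u : ι → Option (Fin n) → Series 𝕜 n} (hw : HasFilteredOrder W 2 fun i => u i none)
    (hφ : ∀ k, HasFilteredOrder W 1 fun i => u i (some k)) :
    (HasFilteredOrder W 2 fun i => step lam (H i) (u i) none) ∧
      ∀ k, HasFilteredOrder W 1 fun i => step lam (H i) (u i) (some k) :=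
  have h := HasFilteredOrder.correct (φ := fun k i => u i (some k)) lam hH hw hφ
  ⟨h, fun k => h.oldFst hφ k⟩

end Filtered

variable {lam : Fin n → 𝕜} {H w w' : Series 𝕜 n} {φ φ' ψ ψ' : Fin n → Series 𝕜 n} {c : ℤ}

theorem substPair_quadraticPart (hφ : ∀ k, HasOrder 1 (φ k)) (hψ : ∀ k, HasOrder 1 (ψ k)) :
    substPair φ ψ (quadraticPart lam) = ∑ k, C (lam k) * (φ k * ψ k) := by
  have ha : HasSubst (Sum.elim φ ψ) := hasSubst_of_constantCoeff_zero fun s => by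
    rcases s with k | k
    exacts [(hφ k).constantCoeff_eq_zero, (hψ k).constantCoeff_eq_zero]
  have hC (r : 𝕜) (f : Series 𝕜 n) : C r * f = r • f := (smul_eq_C_mul f r).symm
  rw [substPair, quadraticPart, ← substAlgHom_apply ha]
  simp only [hC, map_sum, map_smul, map_mul, substAlgHom_X]
  rfl

theorem HasQuadraticPart.hasOrder_sub (h : HasQuadraticPart lam H) :
    HasOrder 3 (H - quadraticPart lam) :=
  hasOrder_iff.mpr fun d hd => by rw [map_sub, h d (by lia), sub_self]

theorem coeff_quadraticPart_of_not_isBalanced {d : Exponent n} (hd : ¬ IsBalanced d) :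
    coeff d (quadraticPart lam) = 0 := by
  classical
  rw [quadraticPart, map_sum]
  refine Finset.sum_eq_zero fun k _ => ?_
  rw [coeff_C_mul, X, X, monomial_mul_monomial, coeff_monomial, if_neg, mul_zero]
  rintro rfl
  refine hd fun j => ?_
  simp [Finsupp.single_apply]

theorem hasOrder_quadraticPart (lam : Fin n → 𝕜) : HasOrder 2 (quadraticPart lam) :=
  .sum fun k _ => by
    simpa [smul_eq_C_mul] using (HasFilteredOrder.mul (hasOrder_X (𝕜 := 𝕜) (Sum.inl k))
      (hasOrder_X (Sum.inr k))).smul (lam k)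

theorem hasOrder_oldFst_sub_X (hw : HasOrder 3 w) (hφ : ∀ k, HasOrder 1 (φ k)) (k : Fin n) :
    HasOrder 2 (oldFst w φ k - X (Sum.inl k)) := by
  have := ((hw.pderiv (Sum.inr k)).substPair (φ := fun k _ => φ k)
    (ψ := fun j _ => MvPowerSeries.X (Sum.inr j)) hφ fun _ => .X _).smul (-1)
  simpa [Birkhoff.oldFst] using this

theorem hasOrder_oldSnd_sub_X (hw : HasOrder 3 w) (hφ : ∀ k, HasOrder 1 (φ k)) (k : Fin n) :
    HasOrder 2 (oldSnd w φ k - X (Sum.inr k)) := by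
  have := ((hw.pderiv (Sum.inl k)).substPair (φ := fun k _ => φ k)
    (ψ := fun j _ => MvPowerSeries.X (Sum.inr j)) hφ fun _ => .X _)
  simpa [Birkhoff.oldSnd] using this

theorem hasOrder_oldFst_sub_oldFst (hw' : HasOrder 3 w')
    (hφ : ∀ k, HasOrder 1 (φ k)) (hφ' : ∀ k, HasOrder 1 (φ' k)) (hww : HasOrder (c + 1) (w - w'))
    (hφφ : ∀ k, HasOrder (c - 1) (φ k - φ' k)) (k : Fin n) :
    HasOrder c (oldFst w φ k - oldFst w' φ' k) := by
  have hf : HasOrder c (pderiv 𝕜 (Sum.inr k) w - pderiv 𝕜 (Sum.inr k) w') := by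
    rw [← map_sub]
    exact (hww.pderiv (Sum.inr k)).mono (by lia)
  have h : HasOrder c (substPair φ (fun j => X (Sum.inr j)) (pderiv 𝕜 (Sum.inr k) w) -
      substPair φ' (fun j => X (Sum.inr j)) (pderiv 𝕜 (Sum.inr k) w')) := by
    refine hasOrder_subst_sub ?_ ?_ (hw'.pderiv _) hf ?_
    · rintro (k | k)
      exacts [hφ k, hasOrder_X _]
    · rintro (k | k)
      exacts [hφ' k, hasOrder_X _]
    · rintro (k | k)
      · exact hφφ k
      · simpa using HasFilteredOrder.zero
  have := h.smul (-1)
  convert this using 2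
  simp only [oldFst, neg_smul, one_smul]
  ring

theorem hasOrder_substPair_pderiv_sub (s : Fin n ⊕ Fin n) (hw' : HasOrder 3 w')
    (hφ : ∀ k, HasOrder 2 (φ k - X (Sum.inl k))) (hφ' : ∀ k, HasOrder 2 (φ' k - X (Sum.inl k)))
    (hww : HasOrder (c + 1) (w - w')) (hφφ : ∀ k, HasOrder c (φ k - φ' k)) :
    HasOrder (c + 1) (substPair φ (fun j => X (Sum.inr j)) (pderiv 𝕜 s w) -
      substPair φ' (fun j => X (Sum.inr j)) (pderiv 𝕜 s w') - pderiv 𝕜 s (w - w')) := by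
  rw [map_sub (pderiv 𝕜 s)]
  refine hasOrder_subst_sub_sub ?_ ?_ (hw'.pderiv s) ?_ ?_
  · rintro (k | k)
    · exact hφ k
    · simpa using HasFilteredOrder.zero
  · rintro (k | k)
    · exact hφ' k
    · simpa using HasFilteredOrder.zero
  · rw [← map_sub]
    exact (hww.pderiv s).mono (by lia)
  · rintro (k | k)
    · exact hφφ k
    · simpa using HasFilteredOrder.zero

theorem coeff_euler (d : Exponent n) (f : Series 𝕜 n) :
    coeff d (∑ k, (X (Sum.inl k) * pderiv 𝕜 (Sum.inl k) f +
      X (Sum.inr k) * pderiv 𝕜 (Sum.inr k) f)) = d.degree * coeff d f := by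
  simp [coeff_X_mul_pderiv, Finsupp.degree_eq_sum, Finset.sum_add_distrib, add_mul, Finset.sum_mul]

theorem coeff_homological (d : Exponent n) (f : Series 𝕜 n) :
    coeff d (∑ k, C (lam k) * (X (Sum.inl k) * pderiv 𝕜 (Sum.inl k) f -
      X (Sum.inr k) * pderiv 𝕜 (Sum.inr k) f)) =
      (∑ k, lam k * (d (Sum.inl k) - d (Sum.inr k))) * coeff d f := by
  simp only [map_sum, coeff_C_mul, map_sub, coeff_X_mul_pderiv, Finset.sum_mul]
  exact Finset.sum_congr rfl fun k _ => by ring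

/-- To first order, the residual changes by `divisor lam d` times the change of `w`. -/
theorem residual_sub_residual (hH : HasQuadraticPart lam H) (hw : HasOrder 3 w)
    (hw' : HasOrder 3 w') (hφ : ∀ k, HasOrder 2 (φ k - X (Sum.inl k)))
    (hφ' : ∀ k, HasOrder 2 (φ' k - X (Sum.inl k))) (hww : HasOrder (c + 1) (w - w'))
    (hφφ : ∀ k, HasOrder c (φ k - φ' k)) {d : Exponent n} (hd : (d.degree : ℤ) < c + 2) :
    residual H (oldFst w φ) (oldSnd w φ) d - residual H (oldFst w' φ') (oldSnd w' φ') d =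
      divisor lam d * coeff d (w - w') := by
  -- Leading variations of the old variables: `-∂(w - w')/∂η` for `x` here, `∂(w - w')/∂x` for `y`
  -- below, with an error one order higher.
  have hx (k) : HasOrder (c + 1)
      (oldFst w φ k - oldFst w' φ' k + pderiv 𝕜 (Sum.inr k) (w - w')) := by
    have := (hasOrder_substPair_pderiv_sub (Sum.inr k) hw' hφ hφ' hww hφφ).smul (-1)
    convert this using 2
    simp only [oldFst, neg_smul, one_smul]
    ring
  have hy (k) : HasOrder (c + 1)
      (oldSnd w φ k - oldSnd w' φ' k - pderiv 𝕜 (Sum.inl k) (w - w')) := by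
    have := hasOrder_substPair_pderiv_sub (Sum.inl k) hw' hφ hφ' hww hφφ
    convert this using 2
    simp only [oldSnd]
    ring
  have h1 := fun k => (hφ k).of_sub_X
  have h1' := fun k => (hφ' k).of_sub_X
  have hw1 (s) : HasOrder c (pderiv 𝕜 s (w - w')) := (hww.pderiv s).mono (by lia)
  set Φ := oldFst w φ
  set Φ' := oldFst w' φ'
  set Ψ := oldSnd w φ
  set Ψ' := oldSnd w' φ'
  have hΦ := hasOrder_oldFst_sub_X hw h1
  have hΨ := hasOrder_oldSnd_sub_X hw h1
  have hΦ' := hasOrder_oldFst_sub_X hw' h1'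
  have hΨ' := hasOrder_oldSnd_sub_X hw' h1'
  by_cases hb : IsBalanced d
  · simp only [residual, divisor, if_pos hb]
    rw [← coeff_euler, ← map_sub, ← sub_eq_zero, ← map_sub]
    refine (hasOrder_iff (c := c + 2)).mp ?_ d hd
    simp only [normalizer, ← Finset.sum_sub_distrib]
    refine .sum fun k _ => ?_
    have := ((HasFilteredOrder.mul (hasOrder_X (Sum.inl k)) (hy k)).sub
      (HasFilteredOrder.mul (hasOrder_X (Sum.inr k)) (hx k))).mono (b := c + 2) (by lia)
    convert this using 2
    ring
  · simp only [residual, divisor, if_neg hb]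
    rw [← coeff_homological, ← map_sub, ← sub_eq_zero, ← map_sub]
    refine (hasOrder_iff (c := c + 2)).mp ?_ d hd
    have hs : ∀ s, HasOrder 1 (Sum.elim Φ Ψ s) := by
      rintro (k | k)
      exacts [(hΦ k).of_sub_X, (hΨ k).of_sub_X]
    have hs' : ∀ s, HasOrder 1 (Sum.elim Φ' Ψ' s) := by
      rintro (k | k)
      exacts [(hΦ' k).of_sub_X, (hΨ' k).of_sub_X]
    have hd' : ∀ s, HasOrder c (Sum.elim Φ Ψ s - Sum.elim Φ' Ψ' s) := by
      rintro (k | k)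
      · simpa using ((hx k).mono (b := c) (by lia)).sub (hw1 (Sum.inr k))
      · simpa using ((hy k).mono (b := c) (by lia)).add (hw1 (Sum.inl k))
    -- The terms of `H` of degree at least 3 vary only to order `c + 2`, so below that order only
    -- the quadratic part counts.
    have h3 := HasFilteredOrder.subst_sub_subst (a := fun s _ => Sum.elim Φ Ψ s)
      (a' := fun s _ => Sum.elim Φ' Ψ' s) hH.hasOrder_sub hs hs' hd'
    have hq : HasOrder (c + 2) (∑ k, (C (lam k) * (Φ k * Ψ k) - C (lam k) * (Φ' k * Ψ' k) -
        C (lam k) * (X (Sum.inl k) * pderiv 𝕜 (Sum.inl k) (w - w') -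
          X (Sum.inr k) * pderiv 𝕜 (Sum.inr k) (w - w')))) := by
      refine .sum fun k _ => ?_
      -- Expand `ΦΨ - Φ'Ψ' = (Φ - Φ')Ψ + Φ'(Ψ - Ψ')`; `e1` and `e3` linearize the differences, `e2`
      -- and `e4` replace `Ψ` and `Φ'` by the coordinates.
      have e1 := ((hx k).mul (hs (Sum.inr k))).mono (b := c + 2) (by lia)
      have e2 := ((hw1 (Sum.inr k)).mul (hΨ k)).mono (b := c + 2) (by lia)
      have e3 := ((hs' (Sum.inl k)).mul (hy k)).mono (b := c + 2) (by lia)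
      have e4 := ((hΦ' k).mul (hw1 (Sum.inl k))).mono (b := c + 2) (by lia)
      have := (((e1.sub e2).add e3).add e4).smul (lam k)
      convert this using 2
      simp only [smul_eq_C_mul, Sum.elim_inl, Sum.elim_inr]
      ring
    convert (h3.mono (b := c + 2) (by lia)).add hq using 2
    have hS := hasSubst_of_constantCoeff_zero fun s => (hs s).constantCoeff_eq_zero
    have hS' := hasSubst_of_constantCoeff_zero fun s => (hs' s).constantCoeff_eq_zero
    change _ = subst (Sum.elim Φ Ψ) _ - subst (Sum.elim Φ' Ψ') _ + _
    rw [subst_sub hS, subst_sub hS']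
    have e := substPair_quadraticPart (lam := lam) (fun k => hs (Sum.inl k))
      (fun k => hs (Sum.inr k))
    have e' := substPair_quadraticPart (lam := lam) (fun k => hs' (Sum.inl k))
      (fun k => hs' (Sum.inr k))
    simp only [substPair, Sum.elim_inl, Sum.elim_inr] at e e' ⊢
    simp only [Finset.sum_sub_distrib]
    change subst (Sum.elim Φ Ψ) _ = _ at e
    change subst (Sum.elim Φ' Ψ') _ = _ at e'
    rw [e, e']
    ring

/-- The identity transformation has zero normalizer and keeps the quadratic part, which is balanced;
a tangent perturbation only matters from degree 3 on. -/
theorem residual_eq_zero (hH : HasQuadraticPart lam H) (hφ : ∀ k, HasOrder 2 (φ k - X (Sum.inl k)))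
    (hψ : ∀ k, HasOrder 2 (ψ k - X (Sum.inr k))) {d : Exponent n} (hd : d.degree < 3) :
    residual H φ ψ d = 0 := by
  have h1 := fun k => (hφ k).of_sub_X
  have h2 := fun k => (hψ k).of_sub_X
  by_cases hb : IsBalanced d
  · simp only [residual, if_pos hb]
    refine (hasOrder_iff (c := 3)).mp (.sum fun k _ => ?_) d (by lia)
    have := ((HasFilteredOrder.mul (hasOrder_X (Sum.inl k)) (hψ k)).sub
      (HasFilteredOrder.mul (hasOrder_X (Sum.inr k)) (hφ k))).mono (b := 3) (by norm_num)
    convert this using 2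
    ring
  · simp only [residual, if_neg hb]
    have hs : ∀ s, HasOrder 1 (Sum.elim φ ψ s) := by
      rintro (k | k)
      exacts [h1 k, h2 k]
    suffices h : HasOrder 3 (substPair φ ψ H - quadraticPart lam) by
      have := hasOrder_iff.mp h d (by lia)
      rwa [map_sub, coeff_quadraticPart_of_not_isBalanced hb, sub_zero] at this
    have h3 := HasFilteredOrder.subst (a := fun s _ => Sum.elim φ ψ s) hH.hasOrder_sub hs
    have hq : HasOrder 3 (substPair φ ψ (quadraticPart lam) - quadraticPart lam) := by
      rw [substPair_quadraticPart h1 h2, quadraticPart, ← Finset.sum_sub_distrib]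
      refine .sum fun k _ => ?_
      have := ((((hφ k).mul (h2 k)).mono (b := 3) (by norm_num)).add
        ((HasFilteredOrder.mul (hasOrder_X (Sum.inl k)) (hψ k)).mono (by norm_num))).smul (lam k)
      convert this using 2
      simp only [smul_eq_C_mul]
      ring
    convert h3.add hq using 2
    have hS := hasSubst_of_constantCoeff_zero fun s => (hs s).constantCoeff_eq_zero
    change _ = subst (Sum.elim φ ψ) _ + (subst (Sum.elim φ ψ) _ - _)
    rw [subst_sub hS, substPair]
    ring

end Normalization

/-! ### Existence and uniqueness of the generating series and of the first integral. -/

section Solution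

variable {𝕜 : Type*} [Field 𝕜] {n : ℕ} {lam : Fin n → 𝕜} {H v w : Series 𝕜 n}
  {φ ψ ξ η : Fin n → Series 𝕜 n}

theorem hasQuadraticPart_iff : HasQuadraticPart lam H ↔ HasOrder 3 (H - quadraticPart lam) :=
  ⟨fun h => h.hasOrder_sub, fun h d hd => by
    rw [← sub_eq_zero, ← map_sub]
    exact hasOrder_iff.mp h d (by lia)⟩

/-- Pairs of a higher order part of a generating series and a tuple tangent to the `ξ_k`. -/
def stepDomain (𝕜 : Type*) [Field 𝕜] (n : ℕ) : Set (Option (Fin n) → Series 𝕜 n) :=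
  {u | HasOrder 3 (u none) ∧ ∀ k, HasOrder 2 (u (some k) - X (Sum.inl k))}

/-- The degree shift for which `step` is contracting. -/
def stepShift {n : ℕ} : Option (Fin n) → ℕ
  | none => 0
  | some _ => 1

theorem mapsTo_step (hH : HasQuadraticPart lam H) :
    Set.MapsTo (step lam H) (stepDomain 𝕜 n) (stepDomain 𝕜 n) := fun u hu => by
  have h1 := fun k => (hu.2 k).of_sub_X
  have h : HasOrder 3 (correct lam H (u none) fun k => u (some k)) := hasOrder_iff.mpr fun d hd => by
    rw [coeff_correct, hasOrder_iff.mp hu.1 d hd, residual_eq_zero hH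
      (hasOrder_oldFst_sub_X hu.1 h1) (hasOrder_oldSnd_sub_X hu.1 h1) (by lia)]
    simp
  exact ⟨h, hasOrder_oldFst_sub_X h h1⟩

/-- Characteristic zero settles the balanced exponents, non-resonance the others. -/
theorem divisor_ne_zero [CharZero 𝕜] (hlam : NonResonant lam) {d : Exponent n} (hd : d ≠ 0) :
    divisor lam d ≠ 0 := by
  by_cases hb : IsBalanced d
  · rw [divisor, if_pos hb]
    exact_mod_cast fun h => hd ((Finsupp.degree_eq_zero_iff d).mp h)
  · rw [divisor, if_neg hb]
    intro h
    refine hb fun k => ?_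
    have := congrFun (hlam (fun k => d (Sum.inl k) - d (Sum.inr k)) ?_) k
    · simp only [Pi.zero_apply] at this
      lia
    · rw [← h]
      exact Finset.sum_congr rfl fun k _ => by push_cast; ring

/-- If `w` is known below degree `N` and `φ` below `N - 1`, the correction cancels the discrepancy
of `w` in degree `N` exactly. The shift by one for `φ` matches the derivative in `oldFst`; there is
a gain because `step` feeds the already corrected `w` into it. -/
theorem agreeBelow_step [CharZero 𝕜] (hlam : NonResonant lam) (hH : HasQuadraticPart lam H) (N : ℕ) :
    ∀ u ∈ stepDomain 𝕜 n, ∀ u' ∈ stepDomain 𝕜 n, AgreeBelow stepShift N u u' →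
      AgreeBelow stepShift (N + 1) (step lam H u) (step lam H u') := fun u hu u' hu' h => by
  rw [agreeBelow_iff_hasOrder] at h ⊢
  have hw : HasOrder (N - 1 + 1) (u none - u' none) := (h none).mono (by simp [stepShift])
  have hφ (k) : HasOrder (N - 1) (u (some k) - u' (some k)) :=
    (h (some k)).mono (by simp [stepShift])
  have hc : HasOrder (N + 1) ((correct lam H (u none) fun k => u (some k)) -
      correct lam H (u' none) fun k => u' (some k)) := hasOrder_iff.mpr fun d hd => by
    have h1 := residual_sub_residual hH hu.1 hu'.1 hu.2 hu'.2 hw hφ (d := d) (by lia)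
    rw [map_sub, coeff_correct, coeff_correct, sub_sub_sub_comm, ← mul_sub, h1, ← map_sub]
    -- At `d = 0` the divisor is zero and nothing is corrected, but both constant terms vanish.
    by_cases h0 : d = 0
    · have : coeff d (u none - u' none) = 0 :=
        hasOrder_iff.mp (hu.1.sub hu'.1) d (by simp [h0])
      rw [this, mul_zero, mul_zero, sub_zero]
    · rw [inv_mul_cancel_left₀ (divisor_ne_zero hlam h0), sub_self]
  rintro (_ | k)
  · exact hc.mono (by simp [stepShift])
  · exact (hasOrder_oldFst_sub_oldFst (c := N) (mapsTo_step hH hu').1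
      (fun k => (hu.2 k).of_sub_X) (fun k => (hu'.2 k).of_sub_X) hc hφ k).mono (by simp [stepShift])

theorem mem_stepDomain_of_agreeBelow (u : Option (Fin n) → Series 𝕜 n)
    (h : ∀ N, ∃ u' ∈ stepDomain 𝕜 n, AgreeBelow stepShift N u u') : u ∈ stepDomain 𝕜 n := by
  refine ⟨hasOrder_iff.mpr fun d hd => ?_, fun k => hasOrder_iff.mpr fun d hd => ?_⟩
  · obtain ⟨u', hu', h⟩ := h 3
    rw [h none d (by simpa [stepShift] using by lia)]
    exact hasOrder_iff.mp hu'.1 d hd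
  · obtain ⟨u', hu', h⟩ := h 3
    rw [map_sub, h (some k) d (by simpa [stepShift] using by lia), ← map_sub]
    exact hasOrder_iff.mp (hu'.2 k) d hd

/-- The starting point of the iteration of `step`. -/
noncomputable def stepStart : Option (Fin n) → Series 𝕜 n
  | none => 0
  | some k => X (Sum.inl k)

theorem stepStart_mem : stepStart ∈ stepDomain 𝕜 n :=
  ⟨HasFilteredOrder.zero, fun k => by simpa [stepStart] using HasFilteredOrder.zero⟩

theorem isFixedPt_step_iff [CharZero 𝕜] (hlam : NonResonant lam) (hH : HasQuadraticPart lam H)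
    {u : Option (Fin n) → Series 𝕜 n} (hu : u ∈ stepDomain 𝕜 n) :
    Function.IsFixedPt (step lam H) u ↔
      (oldFst (u none) fun k => u (some k)) = (fun k => u (some k)) ∧
      ∀ d, residual H (fun k => u (some k)) (oldSnd (u none) fun k => u (some k)) d = 0 := by
  constructor
  · intro h
    have h0 : (correct lam H (u none) fun k => u (some k)) = u none := congrFun h none
    have h1 : (oldFst (u none) fun k => u (some k)) = fun k => u (some k) := by
      ext1 k
      have := congrFun h (some k)
      rwa [step, h0] at this
    refine ⟨h1, fun d => ?_⟩
    -- The fixed point equation says nothing at `d = 0`, where the divisor vanishes; the residual is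
    -- zero there for reasons of degree.
    by_cases hd : d = 0
    · exact residual_eq_zero hH hu.2
        (hasOrder_oldSnd_sub_X hu.1 fun k => (hu.2 k).of_sub_X) (by simp [hd])
    · have := congrArg (coeff d) h0
      rw [coeff_correct, h1, sub_eq_self] at this
      exact (mul_eq_zero.mp this).resolve_left (inv_ne_zero (divisor_ne_zero hlam hd))
  · rintro ⟨h1, h2⟩
    have h0 : (correct lam H (u none) fun k => u (some k)) = u none := by
      ext d
      rw [coeff_correct, h1, h2 d, mul_zero, sub_zero]
    ext1 (_ | k)
    · exact h0
    · rw [step, h0, h1]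

theorem pderiv_inr_quadraticPart (k : Fin n) :
    pderiv 𝕜 (Sum.inr k) (quadraticPart fun _ => (1 : 𝕜)) = X (Sum.inl k) := by
  classical
  simp [quadraticPart, pderiv_X, Pi.single_apply]

theorem pderiv_inl_quadraticPart (k : Fin n) :
    pderiv 𝕜 (Sum.inl k) (quadraticPart fun _ => (1 : 𝕜)) = X (Sum.inr k) := by
  classical
  simp [quadraticPart, pderiv_X, Pi.single_apply]

theorem hasSubst_sumElim (hφ : ∀ k, constantCoeff (φ k) = 0) (hψ : ∀ k, constantCoeff (ψ k) = 0) :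
    HasSubst (Sum.elim φ ψ) :=
  hasSubst_of_constantCoeff_zero fun s => by
    rcases s with k | k
    exacts [hφ k, hψ k]

theorem substPair_pderiv_inr (hφ : ∀ k, constantCoeff (φ k) = 0)
    (hψ : ∀ k, constantCoeff (ψ k) = 0) (k : Fin n) :
    substPair φ ψ (pderiv 𝕜 (Sum.inr k) v) =
      φ k + substPair φ ψ (pderiv 𝕜 (Sum.inr k) (v - quadraticPart fun _ => (1 : 𝕜))) := by
  have hS := hasSubst_sumElim hφ hψ
  rw [map_sub, substPair, substPair, subst_sub hS, pderiv_inr_quadraticPart, subst_X hS]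
  simp

theorem substPair_pderiv_inl (hφ : ∀ k, constantCoeff (φ k) = 0)
    (hψ : ∀ k, constantCoeff (ψ k) = 0) (k : Fin n) :
    substPair φ ψ (pderiv 𝕜 (Sum.inl k) v) =
      ψ k + substPair φ ψ (pderiv 𝕜 (Sum.inl k) (v - quadraticPart fun _ => (1 : 𝕜))) := by
  have hS := hasSubst_sumElim hφ hψ
  rw [map_sub, substPair, substPair, subst_sub hS, pderiv_inl_quadraticPart, subst_X hS]
  simp

/-- Tangency of `φ` to the identity, not demanded by `IsGenerated`, is forced by its equations since
the derivatives of `w` have order 2. -/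
theorem isGenerated_iff (hv : HasOrder 3 (v - quadraticPart fun _ => (1 : 𝕜))) :
    IsGenerated v φ ψ ↔ (∀ k, HasOrder 2 (φ k - X (Sum.inl k))) ∧
      oldFst (v - quadraticPart fun _ => (1 : 𝕜)) φ = φ ∧
      ψ = oldSnd (v - quadraticPart fun _ => (1 : 𝕜)) φ := by
  constructor
  · intro h
    have h1 : oldFst (v - quadraticPart fun _ => (1 : 𝕜)) φ = φ := by
      ext1 k
      rw [oldFst, h.eq_fst k, substPair_pderiv_inr h.constantCoeff_fst (by simp),
        add_sub_cancel_right]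
    refine ⟨fun k => ?_, h1, ?_⟩
    · nth_rw 1 [← h1]
      exact hasOrder_oldFst_sub_X hv (fun k => hasOrder_one_iff.mpr (h.constantCoeff_fst k)) k
    · ext1 k
      rw [oldSnd, h.eq_snd k, substPair_pderiv_inl h.constantCoeff_fst (by simp)]
  · rintro ⟨hφ, h1, rfl⟩
    have h0 := fun k => (hφ k).of_sub_X
    refine ⟨fun k => (h0 k).constantCoeff_eq_zero, fun k =>
      (hasOrder_oldSnd_sub_X hv h0 k).of_sub_X.constantCoeff_eq_zero, fun k => ?_, fun k => ?_⟩
    · rw [substPair_pderiv_inr (fun k => (h0 k).constantCoeff_eq_zero) (by simp)]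
      nth_rw 1 [← h1]
      rw [oldFst, sub_add_cancel]
    · rw [substPair_pderiv_inl (fun k => (h0 k).constantCoeff_eq_zero) (by simp), oldSnd]

theorem forall_residual_eq_zero_iff : (∀ d, residual H φ ψ d = 0) ↔
    (∀ d : Exponent n, ¬ IsBalanced d → coeff d (substPair φ ψ H) = 0) ∧
      ∀ d : Exponent n, IsBalanced d →
        coeff d (∑ k, (X (Sum.inl k) * ψ k - X (Sum.inr k) * φ k)) = 0 := by
  refine ⟨fun h => ⟨fun d hd => ?_, fun d hd => ?_⟩, fun h d => ?_⟩
  · simpa only [residual, if_neg hd] using h d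
  · simpa only [residual, if_pos hd, normalizer] using h d
  · by_cases hd : IsBalanced d
    · simpa only [residual, if_pos hd, normalizer] using h.2 d hd
    · simpa only [residual, if_neg hd] using h.1 d hd

/-- Birkhoff generating series correspond to the fixed points of `step`. -/
theorem isBirkhoffGenerating_iff [CharZero 𝕜] (hlam : NonResonant lam)
    (hH : HasQuadraticPart lam H) :
    IsBirkhoffGenerating H v ↔ ∃ u ∈ stepDomain 𝕜 n, Function.IsFixedPt (step lam H) u ∧
      v - quadraticPart (fun _ => 1) = u none := by
  constructor
  · rintro ⟨hv, φ, ψ, hg, h⟩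
    rw [hasQuadraticPart_iff] at hv
    obtain ⟨hφ, h1, rfl⟩ := (isGenerated_iff hv).mp hg
    let u : Option (Fin n) → Series 𝕜 n := fun o => o.elim (v - quadraticPart fun _ => 1) φ
    have hu : u ∈ stepDomain 𝕜 n := ⟨hv, hφ⟩
    exact ⟨u, hu, (isFixedPt_step_iff hlam hH hu).mpr ⟨h1, forall_residual_eq_zero_iff.mpr h⟩, rfl⟩
  · rintro ⟨u, hu, hfix, h⟩
    have hv : HasOrder 3 (v - quadraticPart fun _ => 1) := h ▸ hu.1
    obtain ⟨h1, h2⟩ := (isFixedPt_step_iff hlam hH hu).mp hfix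
    refine ⟨hasQuadraticPart_iff.mpr hv, fun k => u (some k), _,
      (isGenerated_iff hv).mpr ⟨hu.2, ?_, rfl⟩, ?_⟩
    · rw [h, h1]
    · rw [← forall_residual_eq_zero_iff, h]
      exact h2

/-! ### The new variables in terms of the old ones. -/

/-- `y_k - ∂w/∂x_k (x, η)`: solving `y = ∂v/∂x (x, η)` for the leading term of `η`. -/
noncomputable def newSnd (w : Series 𝕜 n) (η : Fin n → Series 𝕜 n) (k : Fin n) : Series 𝕜 n :=
  X (Sum.inr k) - substPair (fun j => X (Sum.inl j)) η (pderiv 𝕜 (Sum.inl k) w)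

/-- `x_k + ∂w/∂η_k (x, η)`: the value of `ξ_k = ∂v/∂η_k (x, η)`. -/
noncomputable def newFst (w : Series 𝕜 n) (η : Fin n → Series 𝕜 n) (k : Fin n) : Series 𝕜 n :=
  X (Sum.inl k) + substPair (fun j => X (Sum.inl j)) η (pderiv 𝕜 (Sum.inr k) w)

theorem HasFilteredOrder.newSnd {ι : Type*} {W : ℤ → Submodule 𝕜 (ι → 𝕜)} [IsCoeffFiltration W]
    {w : ι → Series 𝕜 n} {η : Fin n → ι → Series 𝕜 n} (hw : HasFilteredOrder W 2 w)
    (hη : ∀ k, HasFilteredOrder W 1 (η k)) (k : Fin n) :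
    HasFilteredOrder W 1 (fun i => newSnd (w i) (fun k => η k i) k) :=
  (HasFilteredOrder.X _).sub
    ((hw.pderiv (Sum.inl k)).substPair (φ := fun j _ => MvPowerSeries.X (Sum.inl j))
      (fun _ => .X _) hη)

theorem HasFilteredOrder.newFst {ι : Type*} {W : ℤ → Submodule 𝕜 (ι → 𝕜)} [IsCoeffFiltration W]
    {w : ι → Series 𝕜 n} {η : Fin n → ι → Series 𝕜 n} (hw : HasFilteredOrder W 2 w)
    (hη : ∀ k, HasFilteredOrder W 1 (η k)) (k : Fin n) :
    HasFilteredOrder W 1 (fun i => newFst (w i) (fun k => η k i) k) :=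
  (HasFilteredOrder.X _).add
    ((hw.pderiv (Sum.inr k)).substPair (φ := fun j _ => MvPowerSeries.X (Sum.inl j))
      (fun _ => .X _) hη)

theorem isGeneratedInverse_iff (hv : HasOrder 3 (v - quadraticPart fun _ => (1 : 𝕜))) :
    IsGeneratedInverse v ξ η ↔ (∀ k, HasOrder 1 (η k)) ∧
      Function.IsFixedPt (newSnd (v - quadraticPart fun _ => (1 : 𝕜))) η ∧
      ξ = newFst (v - quadraticPart fun _ => (1 : 𝕜)) η := by
  constructor
  · intro h
    refine ⟨fun k => hasOrder_one_iff.mpr (h.constantCoeff_snd k), ?_, ?_⟩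
    · ext1 k
      rw [newSnd, h.eq_snd k, substPair_pderiv_inl (by simp) h.constantCoeff_snd,
        add_sub_cancel_right]
    · ext1 k
      rw [newFst, h.eq_fst k, substPair_pderiv_inr (by simp) h.constantCoeff_snd]
  · rintro ⟨hη, h1, rfl⟩
    have h0 := fun k => (hη k).constantCoeff_eq_zero
    refine ⟨fun k => ?_, h0, fun k => ?_, fun k => ?_⟩
    · exact (HasFilteredOrder.newFst (η := fun k _ => η k) (hv.mono (by norm_num)) hη
        k).constantCoeff_eq_zero le_rfl ()
    · rw [substPair_pderiv_inr (by simp) h0, newFst]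
    · rw [substPair_pderiv_inl (by simp) h0]
      nth_rw 1 [← h1]
      rw [newSnd, sub_add_cancel]

theorem mapsTo_newSnd (hw : HasOrder 3 w) :
    Set.MapsTo (newSnd w) {η | ∀ k, HasOrder 1 (η k)} {η | ∀ k, HasOrder 1 (η k)} :=
  fun η hη k => HasFilteredOrder.newSnd (η := fun k _ => η k) (hw.mono (by norm_num)) hη k

/-- Here `w` is fixed and its derivatives have order 2, so substitution alone gains one degree and
no shift is needed. -/
theorem agreeBelow_newSnd (hw : HasOrder 3 w) (N : ℕ) :
    ∀ η ∈ {η : Fin n → Series 𝕜 n | ∀ k, HasOrder 1 (η k)},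
      ∀ η' ∈ {η : Fin n → Series 𝕜 n | ∀ k, HasOrder 1 (η k)},
        AgreeBelow (fun _ => 0) N η η' →
          AgreeBelow (fun _ => 0) (N + 1) (newSnd w η) (newSnd w η') := fun η hη η' hη' h => by
  rw [agreeBelow_iff_hasOrder] at h ⊢
  intro k
  have : HasOrder (N + 1)
      (substPair (fun j => X (Sum.inl j)) η (pderiv 𝕜 (Sum.inl k) w) -
        substPair (fun j => X (Sum.inl j)) η' (pderiv 𝕜 (Sum.inl k) w)) := by
    refine hasOrder_subst_sub ?_ ?_ (hw.pderiv _) ?_ ?_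
    · rintro (k | k)
      exacts [hasOrder_X _, hη k]
    · rintro (k | k)
      exacts [hasOrder_X _, hη' k]
    · simpa using HasFilteredOrder.zero
    · rintro (k | k)
      · simpa using HasFilteredOrder.zero
      · exact (h k).mono (by simp)
  have := (this.smul (-1)).mono (b := ((N + 1 : ℕ) : ℤ) - (0 : ℕ)) (by simp)
  convert this using 2
  simp only [newSnd, neg_smul, one_smul]
  ring

theorem exists_isFixedPt_newSnd (hw : HasOrder 3 w) :
    ∃ η : Fin n → Series 𝕜 n, (∀ k, HasOrder 1 (η k)) ∧ Function.IsFixedPt (newSnd w) η ∧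
      ∀ N, AgreeBelow (fun _ => 0) N η ((newSnd w)^[N] fun _ => 0) := by
  refine exists_isFixedPt (S := {η | ∀ k, HasOrder 1 (η k)}) (mapsTo_newSnd hw)
    (agreeBelow_newSnd hw) (fun η h k => ?_) (fun _ => HasFilteredOrder.zero)
  refine hasOrder_iff.mpr fun d hd => ?_
  obtain ⟨η', hη', h⟩ := h 1
  rw [h k d (by simpa using hd)]
  exact hasOrder_iff.mp (hη' k) d hd

theorem eq_of_isFixedPt_newSnd (hw : HasOrder 3 w) {η η' : Fin n → Series 𝕜 n}
    (hη : ∀ k, HasOrder 1 (η k)) (hη' : ∀ k, HasOrder 1 (η' k))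
    (h : Function.IsFixedPt (newSnd w) η) (h' : Function.IsFixedPt (newSnd w) η') : η = η' :=
  eq_of_isFixedPt (mapsTo_newSnd hw) (agreeBelow_newSnd hw) hη hη' h h'

/-- The data of a universal first integral in terms of fixed points. -/
theorem isUniversalFirstIntegral_iff [CharZero 𝕜] (hlam : NonResonant lam)
    (hH : HasQuadraticPart lam H) {F : MvPowerSeries (Fin n) 𝕜} {P : Series 𝕜 n} :
    IsUniversalFirstIntegral F H P ↔ ∃ u ∈ stepDomain 𝕜 n, Function.IsFixedPt (step lam H) u ∧
      ∃ η : Fin n → Series 𝕜 n, (∀ k, HasOrder 1 (η k)) ∧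
        Function.IsFixedPt (newSnd (u none)) η ∧
        P = subst (fun k => newFst (u none) η k * η k) F := by
  constructor
  · rintro ⟨v, ξ, η, hv, hη, rfl⟩
    obtain ⟨u, hu, hfix, h⟩ := (isBirkhoffGenerating_iff hlam hH).mp hv
    obtain ⟨h1, h2, rfl⟩ := (isGeneratedInverse_iff (h ▸ hu.1)).mp hη
    rw [h] at h2 ⊢
    exact ⟨u, hu, hfix, η, h1, h2, rfl⟩
  · rintro ⟨u, hu, hfix, η, h1, h2, rfl⟩
    have h : u none + quadraticPart (fun _ => 1) - quadraticPart (fun _ => 1) = u none :=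
      add_sub_cancel_right _ _
    refine ⟨u none + quadraticPart fun _ => 1, newFst (u none) η, η,
      (isBirkhoffGenerating_iff hlam hH).mpr ⟨u, hu, hfix, h⟩, ?_, rfl⟩
    rw [isGeneratedInverse_iff (by rw [h]; exact hu.1), h]
    exact ⟨h1, h2, rfl⟩

theorem existsUnique_isUniversalFirstIntegral [CharZero 𝕜] (hlam : NonResonant lam)
    (hH : HasQuadraticPart lam H) (F : MvPowerSeries (Fin n) 𝕜) :
    ∃! P, IsUniversalFirstIntegral F H P := by
  obtain ⟨u, hu, hfix, -⟩ := exists_isFixedPt (mapsTo_step hH) (agreeBelow_step hlam hH)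
    mem_stepDomain_of_agreeBelow stepStart_mem
  obtain ⟨η, hη, hfix', -⟩ := exists_isFixedPt_newSnd hu.1
  refine ⟨_, (isUniversalFirstIntegral_iff hlam hH).mpr ⟨u, hu, hfix, η, hη, hfix', rfl⟩, ?_⟩
  intro P hP
  obtain ⟨u', hu', hfix1, η', hη', hfix1', rfl⟩ := (isUniversalFirstIntegral_iff hlam hH).mp hP
  obtain rfl := eq_of_isFixedPt (mapsTo_step hH) (agreeBelow_step hlam hH) hu hu' hfix hfix1
  obtain rfl := eq_of_isFixedPt_newSnd hu.1 hη hη' hfix' hfix1'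
  rfl

end Solution

/-! ### Polynomial dependence on the coefficients of the hamiltonian. -/

section Dependence

variable {𝕜 ι : Type*} [Field 𝕜] {n : ℕ}

/-- Functions of the parameter that are polynomials of weight at most `k` in the coefficients of
degree at least `3` of the series `h i`, where a coefficient of degree `l` has weight `l - 2`. -/
def coeffWeight (h : ι → Series 𝕜 n) (k : ℤ) : Submodule 𝕜 (ι → 𝕜) :=
  Submodule.span 𝕜 {q | ∃ s : Multiset (Exponent n), (∀ d ∈ s, 3 ≤ d.degree) ∧
    (((s.map fun d => d.degree - 2).sum : ℕ) : ℤ) ≤ k ∧ q = (s.map fun d i => coeff d (h i)).prod}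

instance isCoeffFiltration_coeffWeight (h : ι → Series 𝕜 n) :
    IsCoeffFiltration (coeffWeight h) where
  one_mem := Submodule.subset_span ⟨0, by simp⟩
  mono a b hab := Submodule.span_mono fun q ⟨s, h1, h2, h3⟩ => ⟨s, h1, h2.trans hab, h3⟩
  mul_mem hp hq := by
    have := Submodule.mul_mem_mul hp hq
    rw [coeffWeight, coeffWeight, Submodule.span_mul_span] at this
    refine Submodule.span_mono ?_ this
    rintro _ ⟨_, ⟨s, h1, h2, rfl⟩, _, ⟨t, h1', h2', rfl⟩, rfl⟩
    refine ⟨s + t, fun d hd => ?_, ?_, by simp⟩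
    · rcases Multiset.mem_add.mp hd with hd | hd
      exacts [h1 d hd, h1' d hd]
    · rw [Multiset.map_add, Multiset.sum_add]
      push_cast at h2 h2' ⊢
      lia
  eq_zero {k p} hk hp := by
    have : {q : ι → 𝕜 | ∃ s : Multiset (Exponent n), (∀ d ∈ s, 3 ≤ d.degree) ∧
        (((s.map fun d => d.degree - 2).sum : ℕ) : ℤ) ≤ k ∧
          q = (s.map fun d i => coeff d (h i)).prod} = ∅ :=
      Set.eq_empty_of_forall_notMem fun q ⟨s, _, h2, _⟩ => by
        have := Int.natCast_nonneg (s.map fun d => d.degree - 2).sum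
        lia
    rwa [coeffWeight, this, Submodule.span_empty, Submodule.mem_bot] at hp

/-- In a product of weight at most `l - 1` every factor has weight at least 1, so there are at most
`l - 1` factors; and no single weight exceeds `l - 1`, so no factor has degree above `l + 1`. -/
theorem exists_mvPolynomial_of_mem_coeffWeight {h : ι → Series 𝕜 n} {k : ℤ} {l : ℕ}
    (hk : k + 1 ≤ l) {q : ι → 𝕜} (hq : q ∈ coeffWeight h k) :
    ∃ Q : MvPolynomial (HigherExponent n l) 𝕜, Q.totalDegree ≤ l - 1 ∧
      ∀ i, q i = MvPolynomial.eval (fun d => coeff d.1 (h i)) Q := by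
  rw [coeffWeight] at hq
  induction hq using Submodule.span_induction with
  | mem q hq =>
    obtain ⟨s, h1, h2, rfl⟩ := hq
    have hs : ∀ d ∈ s, 3 ≤ d.degree ∧ d.degree ≤ l + 1 := fun d hd => by
      have := Multiset.single_le_sum (by simp) _
        (Multiset.mem_map_of_mem (fun d : Exponent n => d.degree - 2) hd)
      exact ⟨h1 d hd, by lia⟩
    refine ⟨(s.pmap (fun d hd => MvPolynomial.X ⟨d, hd⟩) hs).prod, ?_, fun i => ?_⟩
    · refine (MvPolynomial.totalDegree_multiset_prod _).trans ?_
      have hcard : s.card ≤ (s.map fun d => d.degree - 2).sum := by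
        have := Multiset.card_nsmul_le_sum (s := s.map fun d => d.degree - 2) (a := 1) fun x hx => by
          obtain ⟨d, hd, rfl⟩ := Multiset.mem_map.mp hx
          have := h1 d hd
          lia
        simpa using this
      simp only [Multiset.map_pmap, MvPolynomial.totalDegree_X, Multiset.pmap_eq_map,
        Multiset.map_const', Multiset.sum_replicate]
      simp
      lia
    · simp only [map_multiset_prod, Multiset.map_pmap, MvPolynomial.eval_X, Multiset.pmap_eq_map,
        Pi.multiset_prod_apply, Multiset.map_map, Function.comp_def]
  | zero => exact ⟨0, by simp⟩
  | add q q' _ _ hq hq' =>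
    obtain ⟨Q, h1, h2⟩ := hq
    obtain ⟨Q', h1', h2'⟩ := hq'
    exact ⟨Q + Q', (MvPolynomial.totalDegree_add _ _).trans (max_le h1 h1'),
      fun i => by simp [h2, h2']⟩
  | smul a q _ hq =>
    obtain ⟨Q, h1, h2⟩ := hq
    exact ⟨a • Q, (MvPolynomial.totalDegree_smul_le _ _).trans h1, fun i => by simp [h2]⟩

variable {lam : Fin n → 𝕜}

/-- Coefficients of degree at most 2 are constants fixed by `lam`; the others are generators of
weight exactly `degree - 2`. -/
theorem hasFilteredOrder_coeffWeight {h : ι → Series 𝕜 n} (hh : ∀ i, HasQuadraticPart lam (h i)) :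
    HasFilteredOrder (coeffWeight h) 2 h := fun d => by
  by_cases hd : d.degree ≤ 2
  · simp only [fun i => hh i d hd]
    exact HasFilteredOrder.of_coeff _ (fun d hd => hasOrder_iff.mp (hasOrder_quadraticPart lam) d hd) d
  · refine Submodule.subset_span ⟨{d}, ?_, ?_, ?_⟩
    · simp
      lia
    · simp
      lia
    · simp

/-- The filtered order of a family of limits can be checked on the approximations. -/
theorem HasFilteredOrder.of_agreeBelow {κ σ : Type*} {W : ℤ → Submodule 𝕜 (ι → 𝕜)} {c : ℤ}
    {s : κ → ℕ} {u : ι → κ → MvPowerSeries σ 𝕜} {u' : ℕ → ι → κ → MvPowerSeries σ 𝕜} {k : κ}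
    (h : ∀ N i, AgreeBelow s N (u i) (u' N i)) (hu : ∀ N, HasFilteredOrder W c fun i => u' N i k) :
    HasFilteredOrder W c fun i => u i k := fun d => by
  have := hu (d.degree + s k + 1) d
  simpa only [← fun i => h (d.degree + s k + 1) i k d (by lia)] using this

theorem hasFilteredOrder_iterate_step {W : ℤ → Submodule 𝕜 (ι → 𝕜)} [IsCoeffFiltration W]
    {h : ι → Series 𝕜 n} (hh : HasFilteredOrder W 2 h) (N : ℕ) :
    (HasFilteredOrder W 2 fun i => (step lam (h i))^[N] stepStart none) ∧
      ∀ k, HasFilteredOrder W 1 fun i => (step lam (h i))^[N] stepStart (some k) := by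
  induction N with
  | zero => exact ⟨HasFilteredOrder.zero, fun k => HasFilteredOrder.X _⟩
  | succ N ih =>
    simp only [Function.iterate_succ_apply']
    exact HasFilteredOrder.step lam hh ih.1 ih.2

theorem hasFilteredOrder_iterate_newSnd {W : ℤ → Submodule 𝕜 (ι → 𝕜)} [IsCoeffFiltration W]
    {w : ι → Series 𝕜 n} (hw : HasFilteredOrder W 2 w) (N : ℕ) (k : Fin n) :
    HasFilteredOrder W 1 fun i => (newSnd (w i))^[N] (fun _ => 0) k := by
  induction N generalizing k with
  | zero => exact HasFilteredOrder.zero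
  | succ N ih =>
    simp only [Function.iterate_succ_apply']
    exact hw.newSnd ih k

theorem subst_eq_C_add {a : Fin n → Series 𝕜 n} (ha : ∀ k, constantCoeff (a k) = 0)
    (F : MvPowerSeries (Fin n) 𝕜) :
    subst a F = C (constantCoeff F) + subst a (F - C (constantCoeff F)) := by
  rw [subst_sub (hasSubst_of_constantCoeff_zero ha), subst_C, add_sub_cancel]

theorem hasFilteredOrder_subst_sub_C {W : ℤ → Submodule 𝕜 (ι → 𝕜)} [IsCoeffFiltration W]
    {a : Fin n → ι → Series 𝕜 n} (ha : ∀ k, HasFilteredOrder W 2 (a k))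
    (F : MvPowerSeries (Fin n) 𝕜) :
    HasFilteredOrder W 2 fun i => subst (fun k => a k i) F - C (constantCoeff F) := by
  have hsub (i) := subst_eq_C_add (fun k => (ha k).constantCoeff_eq_zero (by norm_num) i) F
  simp only [hsub, add_sub_cancel_left]
  -- Each `ω_k` has order 2, so a monomial of degree `e` in them has order `2e`, which is at least 2
  -- once the constant term is removed.
  refine HasFilteredOrder.subst_of_coeff (r := 2) (by norm_num) ha fun e => ?_
  have h1 : HasFilteredOrder W 1 fun _ => F - C (constantCoeff F) :=
    .of_coeff _ fun d hd => by
      have : d = 0 := by rw [← Finsupp.degree_eq_zero_iff]; lia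
      simp [this]
  by_cases he : e = 0
  · have : coeff e (F - C (constantCoeff F)) = 0 := by simp [he]
    simp only [this]
    exact Submodule.zero_mem _
  · have : e.degree ≠ 0 := fun h => he ((Finsupp.degree_eq_zero_iff e).mp h)
    exact IsCoeffFiltration.mono (W := W) (by lia) (h1 e)

theorem exists_hasFilteredOrder_integral [CharZero 𝕜] (hlam : NonResonant lam)
    {h : ι → Series 𝕜 n} (hh : ∀ i, HasQuadraticPart lam (h i)) (F : MvPowerSeries (Fin n) 𝕜) :
    ∃ P : ι → Series 𝕜 n, (∀ i, IsUniversalFirstIntegral F (h i) (P i)) ∧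
      HasFilteredOrder (coeffWeight h) 2 fun i => P i - C (constantCoeff F) := by
  choose u hu hfix happrox using fun i => exists_isFixedPt (mapsTo_step (hh i))
    (agreeBelow_step hlam (hh i)) mem_stepDomain_of_agreeBelow stepStart_mem
  choose η hη hfix' happrox' using fun i => exists_isFixedPt_newSnd (hu i).1
  have hH := hasFilteredOrder_coeffWeight hh
  have hw : HasFilteredOrder (coeffWeight h) 2 fun i => u i none :=
    HasFilteredOrder.of_agreeBelow (s := stepShift)
      (u' := fun N i => (step lam (h i))^[N] stepStart) (fun N i => happrox i N)
      fun N => (hasFilteredOrder_iterate_step hH N).1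
  have hη1 (k) : HasFilteredOrder (coeffWeight h) 1 fun i => η i k :=
    HasFilteredOrder.of_agreeBelow (s := fun _ => 0)
      (u' := fun N i => (newSnd (u i none))^[N] fun _ => 0) (fun N i => happrox' i N)
      fun N => hasFilteredOrder_iterate_newSnd hw N k
  have hω (k) : HasFilteredOrder (coeffWeight h) 2 fun i => newFst (u i none) (η i) k * η i k :=
    ((hw.newFst (η := fun k i => η i k) hη1 k).mul (hη1 k)).mono (by norm_num)
  exact ⟨fun i => subst (fun k => newFst (u i none) (η i) k * η i k) F, fun i =>
    (isUniversalFirstIntegral_iff hlam (hh i)).mpr ⟨u i, hu i, hfix i, η i, hη i, hfix' i, rfl⟩,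
    hasFilteredOrder_subst_sub_C hω F⟩

end Dependence

end Birkhoff

/-- Over `𝕜 = ℝ` or `ℂ`, fix a non-resonant quadratic part `∑ lam k * x_k * y_k` and a formal power
series `F`. Then `P(H) = F (ω_1, …, ω_n)` is well defined for every `H` with this quadratic part,
and each of its coefficients of degree `l` is given by one polynomial (independent of `H`), of
degree at most `l - 1`, in the coefficients of `H_3, …, H_{l+1}`. (For `l = 0` the subtraction
truncates and there are no variables: this coefficient does not depend on `H`.) -/
theorem corollary1p4 {𝕜 : Type*} [RCLike 𝕜] (n : ℕ) (lam : Fin n → 𝕜)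
    (hlam : Birkhoff.NonResonant lam) (F : MvPowerSeries (Fin n) 𝕜) :
    (∀ H : Birkhoff.Series 𝕜 n, Birkhoff.HasQuadraticPart lam H →
      ∃! P : Birkhoff.Series 𝕜 n, Birkhoff.IsUniversalFirstIntegral F H P) ∧
    ∀ (l : ℕ) (m : Birkhoff.Exponent n), m.degree = l →
      ∃ Q : MvPolynomial (Birkhoff.HigherExponent n l) 𝕜,
        Q.totalDegree ≤ l - 1 ∧
        ∀ H P : Birkhoff.Series 𝕜 n, Birkhoff.HasQuadraticPart lam H →
          Birkhoff.IsUniversalFirstIntegral F H P →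
          MvPowerSeries.coeff m P =
            MvPolynomial.eval (fun d => MvPowerSeries.coeff d.1 H) Q := by
  refine ⟨fun H hH => Birkhoff.existsUnique_isUniversalFirstIntegral hlam hH F, fun l m hm => ?_⟩
  -- The parameter set consists of all admissible hamiltonians at once, which makes `Q` independent
  -- of `H`.
  obtain ⟨P, hP, hord⟩ := Birkhoff.exists_hasFilteredOrder_integral hlam
    (h := fun H : {H : Birkhoff.Series 𝕜 n // Birkhoff.HasQuadraticPart lam H} => H.1)
    (fun H => H.2) F
  have huniq (H : Birkhoff.Series 𝕜 n) (Q) (hH : Birkhoff.HasQuadraticPart lam H)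
      (hQ : Birkhoff.IsUniversalFirstIntegral F H Q) : Q = P ⟨H, hH⟩ :=
    (Birkhoff.existsUnique_isUniversalFirstIntegral hlam hH F).unique hQ (hP ⟨H, hH⟩)
  -- The weight bound concerns `P - F(0)`; only for `l = 0` does the constant have to be added back.
  rcases Nat.eq_zero_or_pos l with rfl | hl
  · obtain rfl : m = 0 := (Finsupp.degree_eq_zero_iff m).mp hm
    refine ⟨MvPolynomial.C (constantCoeff F), by simp, fun H Q hH hQ => ?_⟩
    have := hord.coeff_eq_zero (d := 0) (by simp) ⟨H, hH⟩
    rw [map_sub, sub_eq_zero] at this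
    rw [huniq H Q hH hQ, this]
    simp
  · obtain ⟨Q, hQ, heval⟩ := Birkhoff.exists_mvPolynomial_of_mem_coeffWeight (l := l)
      (by rw [hm]; lia) (hord m)
    refine ⟨Q, hQ, fun H R hH hR => ?_⟩
    have h0 : coeff m (C (constantCoeff F) : Birkhoff.Series 𝕜 n) = 0 :=
      coeff_C_of_ne_zero (by rintro rfl; simp at hm; lia) _
    rw [huniq H R hH hR, ← heval ⟨H, hH⟩, map_sub, h0, sub_zero]
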